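/- Let $k$ be a field. Let $\mathbf{Art}$ be the category of Artinian local $k$-algebras with residue field $k$, and let $\mathrm{QCoh}$ be the category of pairs $(X,M)$ with $X$ a $k$-scheme and $M$ a quasi-coherent sheaf on $X$, a morphism $(X,M)\to(Y,N)$ being a $k$-morphism $f:X\to Y$ together with an $\mathcal{O}_Y$-linear map $N\to f_*M$. For a $k$-scheme $X$ and $A\in\mathbf{Art}$, a deformation of $X$ over $A$ is a flat $A$-scheme $\mathcal{X}$ with a closed immersion $X\to\mathcal{X}$ that identifies $X$ with $\mathcal{X}\times_{\operatorname{Spec}A}\operatorname{Spec}k$; an isomorphism of deformations is an $A$-isomorphism compatible with the immersions of $X$. Let $D_X:\mathbf{Art}\to\mathbf{Sets}$ be the functor of isomorphism classes of deformations of $X$, with base change. A fibered deformation of $X$ over $A$ is a pair $(\mathcal{X},\Omega_{\mathcal{X}/k})$ with $\mathcal{X}$ a deformation of $X$ over $A$ (the second member being a sheaf on $\mathcal{X}$ isomorphic to $\Omega_{\mathcal{X}/k}$); an isomorphism of fibered deformations is an isomorphism of deformations together with an isomorphism of the sheaves over it. Let $D_{\Omega_{X/k}}:\mathbf{Art}\to\mathbf{Sets}$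 be the functor of isomorphism classes of fibered deformations of $X$, where $B\to A$ sends the class of $(\mathcal{X},\Omega_{\mathcal{X}/k})$ to that of $(\mathcal{X}_A,\Omega_{\mathcal{X}_A/k})$ with $\mathcal{X}_A=\mathcal{X}\times_{\operatorname{Spec}B}\operatorname{Spec}A$. Then $X\mapsto(X,\Omega_{X/k})$ is a functor from the category of $k$-schemes to $\mathrm{QCoh}$ (in particular each $\Omega_{X/k}$ is quasi-coherent), and it is smooth in the following sense: for every $k$-scheme $X$, the assignment $\mathcal{X}\mapsto(\mathcal{X},\Omega_{\mathcal{X}/k})$ is a well-defined morphism of functors $\Theta_X:D_X\to D_{\Omega_{X/k}}$, and for every surjective morphism $B\to A$ in $\mathbf{Art}$ the map $$D_X(B)\to D_X(A)\times_{D_{\Omega_{X/k}}(A)}D_{\Omega_{X/k}}(B)$$ is surjective. -/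

import Mathlib

open CategoryTheory AlgebraicGeometry Opposite

universe u

noncomputable section

namespace OmegaSmooth

variable {k : Type u} [Field k]
/-! ### The sheaf of differentials of a scheme over a field -/

/-- The structure map `k → Γ(X, U)` of a `k`-scheme, as a morphism of presheaves of rings from
the constant presheaf `k`. -/
def structMap (X : Over (Spec (.of k))) :
    (Functor.const _).obj (CommRingCat.of k) ⟶ X.left.presheaf where
  app U := (Scheme.ΓSpecIso (.of k)).inv ≫ X.hom.appLE ⊤ U.unop (by simp)
  naturality U V f := by
    simpa using (Scheme.Hom.appLE_map X.hom (by simp) f).symm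

/-- The presheaf of modules `U ↦ Ω_{Γ(X, U)/k}`. -/
def preOmega (X : Over (Spec (.of k))) : X.left.PresheafOfModules :=
  PresheafOfModules.DifferentialsConstruction.relativeDifferentials' (structMap X)

/-- The sheaf of differentials `Ω_{X/k}`: the sheaf of `𝒪_X`-modules associated with the presheaf
`U ↦ Ω_{Γ(X, U)/k}`. -/
def omegaSheaf (X : Over (Spec (.of k))) : X.left.Modules :=
  (PresheafOfModules.sheafification (𝟙 X.left.ringCatSheaf.obj)).obj (preOmega X)

/-- The `k`-derivations of `𝒪_X` with values in a sheaf of `𝒪_X`-modules `M`. -/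
structure Deriv (X : Over (Spec (.of k))) (M : X.left.Modules) where
  d (U : X.left.Opens) : Γ(X.left, U) →+ Γ(M, U)
  d_mul (U : X.left.Opens) (a b : Γ(X.left, U)) : d U (a * b) = a • d U b + b • d U a
  d_map {U V : X.left.Opens} (i : U ⟶ V) (a : Γ(X.left, V)) :
    d U (X.left.presheaf.map i.op a) = M.presheaf.map i.op (d V a)
  d_const (U : X.left.Opens) (c : k) : d U ((structMap X).app (op U) c) = 0

/-- The canonical map from the presheaf of differentials to its associated sheaf. -/
def toOmega (X : Over (Spec (.of k))) :
    preOmega X ⟶ (PresheafOfModules.restrictScalars (𝟙 X.left.ringCatSheaf.obj)).obj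
      ((SheafOfModules.forget _).obj (omegaSheaf X)) :=
  (PresheafOfModules.sheafificationAdjunction (𝟙 X.left.ringCatSheaf.obj)).unit.app (preOmega X)

/-- The universal derivation, in Mathlib's form. -/
def preDeriv (X : Over (Spec (.of k))) : PresheafOfModules.Derivation'
   ((PresheafOfModules.restrictScalars (𝟙 X.left.ringCatSheaf.obj)).obj
      ((SheafOfModules.forget _).obj (omegaSheaf X))) (structMap X) :=
  (PresheafOfModules.DifferentialsConstruction.derivation' (structMap X)).postcomp (toOmega X)

/-- The universal derivation `d : 𝒪_X → Ω_{X/k}`. -/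
def univDeriv (X : Over (Spec (.of k))) : Deriv X (omegaSheaf X) where
  d U := (preDeriv X).d (X := op U)
  d_mul U a b := (preDeriv X).d_mul (X := op U) a b
  d_map i a := (preDeriv X).d_map i.op a
  d_const U c := (preDeriv X).d_app (X := op U) c

variable {X Y : Over (Spec (.of k))}
/-- A derivation, in Mathlib's form. -/
def Deriv.toDerivation' {M : X.left.Modules} (D : Deriv X M) : PresheafOfModules.Derivation'
   ((PresheafOfModules.restrictScalars (𝟙 X.left.ringCatSheaf.obj)).obj
      ((SheafOfModules.forget _).obj M)) (structMap X) where
  d {U} := D.d U.unop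
  d_mul {U} a b := D.d_mul U.unop a b
  d_map {U V} f a := D.d_map f.unop a
  d_app {U} a := D.d_const U.unop a

/-- The morphism `Ω_{X/k} ⟶ M` induced by a derivation with values in `M`. -/
def Deriv.desc {M : X.left.Modules} (D : Deriv X M) : omegaSheaf X ⟶ M :=
  ((PresheafOfModules.sheafificationAdjunction (𝟙 X.left.ringCatSheaf.obj)).homEquiv (preOmega X) M).symm
    ((PresheafOfModules.DifferentialsConstruction.isUniversal' (structMap X)).desc D.toDerivation')

theorem Deriv.desc_d {M : X.left.Modules} (D : Deriv X M) (U : X.left.Opens) (a : Γ(X.left, U)) :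
    D.desc.app U ((univDeriv X).d U a) = D.d U a := by
  have h1 := ((PresheafOfModules.sheafificationAdjunction (𝟙 X.left.ringCatSheaf.obj)).homEquiv
    (preOmega X) M).apply_symm_apply
    ((PresheafOfModules.DifferentialsConstruction.isUniversal' (structMap X)).desc D.toDerivation')
  replace h1 := (Adjunction.homEquiv_unit
    (adj := PresheafOfModules.sheafificationAdjunction (𝟙 X.left.ringCatSheaf.obj))
    (X := preOmega X) (Y := M) (f := D.desc)).symm.trans h1
  have h2 := (PresheafOfModules.DifferentialsConstruction.isUniversal' (structMap X)).fac
    D.toDerivation'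
  rw [← h1] at h2
  exact PresheafOfModules.Derivation.congr_d h2 (X := op U) a

theorem omega_hom_ext {M : X.left.Modules} (α β : omegaSheaf X ⟶ M)
    (h : ∀ U (a : Γ(X.left, U)),
      α.app U ((univDeriv X).d U a) = β.app U ((univDeriv X).d U a)) : α = β := by
  apply ((PresheafOfModules.sheafificationAdjunction (𝟙 X.left.ringCatSheaf.obj)).homEquiv
    (preOmega X) M).injective
  refine (Adjunction.homEquiv_unit ..).trans (Eq.trans ?_ (Adjunction.homEquiv_unit ..).symm)
  apply (PresheafOfModules.DifferentialsConstruction.isUniversal' (structMap X)).postcomp_injective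
  ext U a
  exact h U.unop a

/-- For a morphism `f : X ⟶ Y` of `k`-schemes, the derivation `b ↦ d(f^♯ b)` of `𝒪_Y` with values
in `f_* Ω_{X/k}`. -/
def pushDeriv (f : X ⟶ Y) : Deriv Y ((Scheme.Modules.pushforward f.left).obj (omegaSheaf X)) where
  d U := ((univDeriv X).d (f.left ⁻¹ᵁ U)).comp (f.left.app U).hom.toAddMonoidHom
  d_mul U a b := by
    have := (univDeriv X).d_mul (f.left ⁻¹ᵁ U) (f.left.app U a) (f.left.app U b)
    rw [← map_mul] at this
    exact this
  d_map {U V} i a := by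
    have := (univDeriv X).d_map ((TopologicalSpace.Opens.map f.left.base).map i) (f.left.app V a)
    refine Eq.trans ?_ this
    have h := congr($(f.left.naturality i.op) a)
    exact congrArg ((univDeriv X).d (f.left ⁻¹ᵁ U)) h
  d_const U c := by
    refine Eq.trans ?_ ((univDeriv X).d_const (f.left ⁻¹ᵁ U) c)
    have h : (structMap Y).app (op U) ≫ f.left.app U = (structMap X).app (op (f.left ⁻¹ᵁ U)) := by
      have hw : f.left ≫ Y.hom = X.hom := Over.w f
      have : X.hom.appLE ⊤ (f.left ⁻¹ᵁ U) (by simp) =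
          Y.hom.appLE ⊤ U (by simp) ≫ f.left.app U := by
        rw [Scheme.Hom.app_eq_appLE]
        refine Eq.trans ?_ (Scheme.Hom.appLE_comp_appLE f.left Y.hom _ _ _ _ _).symm
        simp only [hw]
      simp only [structMap, Category.assoc]
      rw [this]
    exact congrArg ((univDeriv X).d (f.left ⁻¹ᵁ U)) congr($h c)

/-- The canonical map `Ω_{Y/k} ⟶ f_* Ω_{X/k}`, `db ↦ d(f^♯ b)` (the adjoint of
`f^* Ω_{Y/k} ⟶ Ω_{X/k}`). -/
def omegaMap (f : X ⟶ Y) : omegaSheaf Y ⟶ (Scheme.Modules.pushforward f.left).obj (omegaSheaf X) :=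
  (pushDeriv f).desc

theorem omegaMap_d (f : X ⟶ Y) (U : Y.left.Opens) (a : Γ(Y.left, U)) :
    (omegaMap f).app U ((univDeriv Y).d U a) =
      (univDeriv X).d (f.left ⁻¹ᵁ U) (f.left.app U a) :=
  (pushDeriv f).desc_d U a

/-! ### The category of quasi-coherent sheaves over varying `k`-schemes -/

/-- Pairs consisting of a `k`-scheme and a sheaf of modules on it. -/
structure ModOver (k : Type u) [Field k] where
  base : Over (Spec (.of k))
  sheaf : base.left.Modules

/-- A morphism `(X, M) ⟶ (Y, N)` is a morphism `f : X ⟶ Y` of `k`-schemes with an `𝒪_Y`-linear map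
`N ⟶ f_* M` (equivalently `f^* N ⟶ M`). -/
structure ModOver.Hom (E F : ModOver k) where
  base : E.base ⟶ F.base
  map : F.sheaf ⟶ (Scheme.Modules.pushforward base.left).obj E.sheaf

theorem ModOver.Hom.ext_app {E F : ModOver k} {f g : ModOver.Hom E F} (h : f.base = g.base)
    (h' : ∀ U (s : Γ(F.sheaf, U)), E.sheaf.presheaf.map (eqToHom (by rw [h])).op (f.map.app U s) =
      g.map.app U s) : f = g := by
  obtain ⟨f, α⟩ := f
  obtain ⟨g, β⟩ := g
  obtain rfl : f = g := h
  congr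
  ext U s
  refine Eq.trans ?_ (h' U s)
  exact congr($(E.sheaf.presheaf.map_id _) (α.app U s)).symm

instance : Category (ModOver k) where
  Hom := ModOver.Hom
  id E := ⟨𝟙 _, (Scheme.Modules.pushforwardId _).inv.app E.sheaf⟩
  comp f g := ⟨f.base ≫ g.base, g.map ≫ (Scheme.Modules.pushforward g.base.left).map f.map ≫
    (Scheme.Modules.pushforwardComp f.base.left g.base.left).hom.app _⟩
  id_comp {E F} f := ModOver.Hom.ext_app (Category.id_comp _) fun U s =>
    congr($(E.sheaf.presheaf.map_id _) (f.map.app U s))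
  comp_id {E F} f := ModOver.Hom.ext_app (Category.comp_id _) fun U s =>
    congr($(E.sheaf.presheaf.map_id _) (f.map.app U s))
  assoc {E F G H} f g h := ModOver.Hom.ext_app (Category.assoc _ _ _) fun U s =>
    congr($(E.sheaf.presheaf.map_id _) (f.map.app _ (g.map.app _ (h.map.app U s))))

/-- The sheaf of the pair is quasi-coherent. -/
def isQCoh (k : Type u) [Field k] : ObjectProperty (ModOver k) :=
  fun E => E.sheaf.IsQuasicoherent

/-- The category of pairs `(X, M)` with `X` a `k`-scheme and `M` a quasi-coherent sheaf on `X`. -/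
abbrev QCoh (k : Type u) [Field k] := (isQCoh k).FullSubcategory

attribute [local irreducible] omegaSheaf univDeriv omegaMap

theorem omegaMap_id (X : Over (Spec (.of k))) :
    omegaMap (𝟙 X) = (Scheme.Modules.pushforwardId _).inv.app (omegaSheaf X) := by
  apply omega_hom_ext
  intro U a
  exact omegaMap_d (𝟙 X) U a

theorem omegaMap_comp {X Y Z : Over (Spec (.of k))} (f : X ⟶ Y) (g : Y ⟶ Z) :
    omegaMap (f ≫ g) = omegaMap g ≫ (Scheme.Modules.pushforward g.left).map (omegaMap f) ≫
      (Scheme.Modules.pushforwardComp f.left g.left).hom.app (omegaSheaf X) := by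
  apply omega_hom_ext
  intro U a
  have h1 := omegaMap_d g U a
  have h2 := omegaMap_d f (g.left ⁻¹ᵁ U) (g.left.app U a)
  rw [← h1] at h2
  have h3 := omegaMap_d (f ≫ g) U a
  rw [h3]
  exact h2.symm

/-- The functor `X ↦ (X, Ω_{X/k})`. -/
def omega (k : Type u) [Field k] : Over (Spec (.of k)) ⥤ ModOver k where
  obj X := ⟨X, omegaSheaf X⟩
  map f := ⟨f, omegaMap f⟩
  map_id X := 
    congrArg (ModOver.Hom.mk (E := ⟨X, omegaSheaf X⟩) (F := ⟨X, omegaSheaf X⟩) (𝟙 X))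
      (omegaMap_id X)
  map_comp {X Y Z} f g :=
    congrArg (ModOver.Hom.mk (E := ⟨X, omegaSheaf X⟩) (F := ⟨Z, omegaSheaf Z⟩) (f ≫ g))
      (omegaMap_comp f g)

/-! ### Artinian local `k`-algebras and deformations of schemes -/

/-- Artinian local `k`-algebras with residue field `k`. -/
def isArt (k : Type u) [Field k] : ObjectProperty (CommAlgCat.{u} k) := fun A =>
  IsArtinianRing A ∧ ∃ _ : IsLocalRing A,
    Function.Bijective (algebraMap k (IsLocalRing.ResidueField A))

/-- The category of Artinian local `k`-algebras with residue field `k`; its morphisms are the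
`k`-algebra homomorphisms (which are automatically local). -/
abbrev Art (k : Type u) [Field k] := (isArt k).FullSubcategory

namespace Art
instance (A : Art k) : IsLocalRing A.obj := A.property.2.choose

/-- The residue map `A → k`. -/
def aug (A : Art k) : A.obj →ₐ[k] k :=
  ((AlgEquiv.ofBijective (Algebra.ofId k (IsLocalRing.ResidueField A.obj))
    A.property.2.choose_spec).symm : IsLocalRing.ResidueField A.obj →ₐ[k] k).comp
    (IsScalarTower.toAlgHom k A.obj (IsLocalRing.ResidueField A.obj))

theorem algHom_unique (A : Art k) (f g : A.obj →ₐ[k] k) : f = g := by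
  have hf (h : A.obj →ₐ[k] k) : RingHom.ker h = IsLocalRing.maximalIdeal A.obj := by
    have : Function.Surjective h := fun c => ⟨algebraMap k _ c, by simp⟩
    exact IsLocalRing.eq_maximalIdeal (RingHom.ker_isMaximal_of_surjective h this)
  ext a
  have h1 : a - algebraMap k _ (f a) ∈ RingHom.ker f := by simp [RingHom.mem_ker]
  rw [hf f, ← hf g, RingHom.mem_ker] at h1
  rw [map_sub, AlgHom.commutes, sub_eq_zero] at h1
  exact h1.symm

/-- The scheme `Spec A`. -/
abbrev spec (A : Art k) : Scheme.{u} := Spec (.of A.obj)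

/-- The morphism `Spec A ⟶ Spec B` of `f : B ⟶ A`. -/
def specMap {B A : Art k} (f : B ⟶ A) : A.spec ⟶ B.spec :=
  Spec.map (CommRingCat.ofHom f.hom.hom.toRingHom)

/-- The closed point `Spec k ⟶ Spec A`. -/
def point (A : Art k) : Spec (.of k) ⟶ A.spec := Spec.map (CommRingCat.ofHom A.aug.toRingHom)

/-- The structure morphism `Spec A ⟶ Spec k`. -/
def toField (A : Art k) : A.spec ⟶ Spec (.of k) :=
  Spec.map (CommRingCat.ofHom (algebraMap k A.obj))

theorem point_toField (A : Art k) : A.point ≫ A.toField = 𝟙 _ := by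
  rw [point, toField, ← Spec.map_comp, ← CommRingCat.ofHom_comp, ← Spec.map_id]
  congr 1
  ext x
  simp

theorem specMap_toField {B A : Art k} (f : B ⟶ A) : specMap f ≫ B.toField = A.toField := by
  rw [specMap, toField, toField, ← Spec.map_comp, ← CommRingCat.ofHom_comp]
  congr 1
  ext x
  simp

theorem point_specMap {B A : Art k} (f : B ⟶ A) : A.point ≫ specMap f = B.point := by
  rw [specMap, point, point, ← Spec.map_comp, ← CommRingCat.ofHom_comp]
  have := B.algHom_unique (A.aug.comp f.hom.hom) B.aug
  congr 2
  exact congrArg AlgHom.toRingHom this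

theorem specMap_id (A : Art k) : specMap (𝟙 A) = 𝟙 _ := Spec.map_id _
theorem specMap_comp {C B A : Art k} (f : C ⟶ B) (g : B ⟶ A) :
    specMap (f ≫ g) = specMap g ≫ specMap f := by
  rw [specMap, specMap, specMap, ← Spec.map_comp, ← CommRingCat.ofHom_comp]
  rfl

theorem isClosedImmersion_point (A : Art k) : IsClosedImmersion A.point :=
  IsClosedImmersion.spec_of_surjective _ fun c => ⟨algebraMap k A.obj c, by simp⟩
end Art

/-- An (infinitesimal) deformation of the `k`-scheme `X` over `A`: a flat `A`-scheme `total` with a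
closed immersion `i` of `X` which identifies `X` with the closed fibre. -/
structure Deformation (X : Over (Spec (.of k))) (A : Art k) where
  total : Scheme.{u}
  π : total ⟶ A.spec
  i : X.left ⟶ total
  flat : Flat π
  closed : IsClosedImmersion i
  isPullback : IsPullback i X.hom π A.point

namespace Deformation
variable {X : Over (Spec (.of k))} {A B C : Art k}

/-- The total space of a deformation, as a `k`-scheme. -/
abbrev toOver (D : Deformation X A) : Over (Spec (.of k)) := Over.mk (D.π ≫ A.toField)

/-- Isomorphisms of deformations: isomorphisms over `A` that are the identity on `X`. -/
structure Iso (D D' : Deformation X A) where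
  e : D.total ≅ D'.total
  π : e.hom ≫ D'.π = D.π
  i : D.i ≫ e.hom = D'.i

instance setoid (X : Over (Spec (.of k))) (A : Art k) : Setoid (Deformation X A) where
  r D D' := Nonempty (Iso D D')
  iseqv :=
    { refl D := ⟨⟨.refl _, by simp, by simp⟩⟩
      symm := fun ⟨φ⟩ => ⟨⟨φ.e.symm, by simp [← φ.π], by simp [← φ.i]⟩⟩
      trans := fun ⟨φ⟩ ⟨ψ⟩ => ⟨⟨φ.e ≪≫ ψ.e, by simp [φ.π, ψ.π], by simp [reassoc_of% φ.i, ψ.i]⟩⟩ }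

/-- The inclusion of `X` in the base change of a deformation. -/
def baseChangeι (f : B ⟶ A) (D : Deformation X B) :
    X.left ⟶ Limits.pullback D.π (Art.specMap f) :=
  Limits.pullback.lift D.i (X.hom ≫ A.point)
    (by rw [D.isPullback.w, Category.assoc, Art.point_specMap])

theorem baseChangeι_fst (f : B ⟶ A) (D : Deformation X B) :
    D.baseChangeι f ≫ Limits.pullback.fst D.π (Art.specMap f) = D.i :=
  Limits.pullback.lift_fst ..

theorem baseChangeι_snd (f : B ⟶ A) (D : Deformation X B) :
    D.baseChangeι f ≫ Limits.pullback.snd D.π (Art.specMap f) = X.hom ≫ A.point :=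
  Limits.pullback.lift_snd ..

theorem baseChange_isPullback (f : B ⟶ A) (D : Deformation X B) :
    IsPullback (D.baseChangeι f) X.hom (Limits.pullback.snd D.π (Art.specMap f)) A.point := by
  refine IsPullback.of_right ?_ (D.baseChangeι_snd f)
    (IsPullback.of_hasPullback D.π (Art.specMap f))
  rw [baseChangeι_fst, Art.point_specMap]
  exact D.isPullback

/-- The base change of a deformation along `f : B ⟶ A`. -/
def baseChange (f : B ⟶ A) (D : Deformation X B) : Deformation X A where
  total := Limits.pullback D.π (Art.specMap f)
  π := Limits.pullback.snd _ _
  i := D.baseChangeι f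
  flat := MorphismProperty.of_isPullback (P := @Flat)
    (IsPullback.of_hasPullback D.π (Art.specMap f)) D.flat
  closed := MorphismProperty.of_isPullback (D.baseChange_isPullback f).flip
    A.isClosedImmersion_point
  isPullback := D.baseChange_isPullback f

/-- The projection from the base change to the original total space. -/
def baseChangeFst (f : B ⟶ A) (D : Deformation X B) : (D.baseChange f).total ⟶ D.total :=
  Limits.pullback.fst D.π (Art.specMap f)

theorem baseChangeFst_isPullback (f : B ⟶ A) (D : Deformation X B) :
    IsPullback (D.baseChangeFst f) (D.baseChange f).π D.π (Art.specMap f) :=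
  IsPullback.of_hasPullback D.π (Art.specMap f)

theorem i_baseChangeFst (f : B ⟶ A) (D : Deformation X B) :
    (D.baseChange f).i ≫ D.baseChangeFst f = D.i :=
  D.baseChangeι_fst f

theorem baseChange_equiv (f : B ⟶ A) (D : Deformation X B) (E : Deformation X A)
    (g : E.total ⟶ D.total) (h : IsPullback g E.π D.π (Art.specMap f)) (hi : E.i ≫ g = D.i) :
    D.baseChange f ≈ E := by
  refine ⟨⟨(D.baseChangeFst_isPullback f).isoIsPullback _ _ h,
    IsPullback.isoIsPullback_hom_snd .., ?_⟩⟩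
  apply h.hom_ext
  · rw [Category.assoc, IsPullback.isoIsPullback_hom_fst, hi, i_baseChangeFst]
  · rw [Category.assoc, IsPullback.isoIsPullback_hom_snd, E.isPullback.w,
      (D.baseChange f).isPullback.w]

theorem baseChange_congr (f : B ⟶ A) {D D' : Deformation X B} (h : D ≈ D') :
    D.baseChange f ≈ D'.baseChange f := by
  obtain ⟨φ⟩ := h
  refine baseChange_equiv f D (D'.baseChange f) (D'.baseChangeFst f ≫ φ.e.inv) ?_ ?_
  · refine IsPullback.of_iso (D'.baseChangeFst_isPullback f) (.refl _) φ.e.symm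
      (.refl _) (.refl _) ?_ ?_ ?_ ?_ <;> simp [← φ.π]
  · rw [← Category.assoc, i_baseChangeFst, ← φ.i]
    simp

theorem baseChange_id (D : Deformation X A) : D.baseChange (𝟙 A) ≈ D := by
  refine baseChange_equiv _ D D (𝟙 _) ?_ (by simp)
  rw [Art.specMap_id]
  exact IsPullback.of_id_fst

theorem baseChange_comp (f : C ⟶ B) (g : B ⟶ A) (D : Deformation X C) :
    D.baseChange (f ≫ g) ≈ (D.baseChange f).baseChange g := by
  refine baseChange_equiv _ D ((D.baseChange f).baseChange g)
    ((D.baseChange f).baseChangeFst g ≫ D.baseChangeFst f) ?_ ?_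
  · rw [Art.specMap_comp]
    exact ((D.baseChange f).baseChangeFst_isPullback g).paste_horiz (D.baseChangeFst_isPullback f)
  · rw [← Category.assoc, i_baseChangeFst, i_baseChangeFst]

end Deformation

/-- The deformation functor `D_X`: isomorphism classes of deformations of `X`, with base change. -/
def defFunctor (X : Over (Spec (.of k))) : Art k ⥤ Type (u + 1) where
  obj A := Quotient (Deformation.setoid X A)
  map f := TypeCat.ofHom (Quotient.map (Deformation.baseChange f)
    fun _ _ => Deformation.baseChange_congr f)
  map_id A := by
    ext ⟨D⟩
    exact Quotient.sound D.baseChange_id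
  map_comp {A B C} f g := by
    ext ⟨D⟩
    exact Quotient.sound (D.baseChange_comp f g)


/-! ### Fibered deformations -/

/-- An isomorphism of sheaves on a fixed `k`-scheme, seen in `ModOver k`. -/
def ModOver.fiberIso (X : Over (Spec (.of k))) {M N : X.left.Modules} (e : M ≅ N) :
    ModOver.mk X M ≅ ModOver.mk X N where
  hom := ⟨𝟙 X, e.inv ≫ (Scheme.Modules.pushforwardId _).inv.app M⟩
  inv := ⟨𝟙 X, e.hom ≫ (Scheme.Modules.pushforwardId _).inv.app N⟩
  hom_inv_id := ModOver.Hom.ext_app (Category.comp_id _) fun U s =>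
    congr($(M.presheaf.map_id _) ((e.hom ≫ e.inv).app U s)).trans (by rw [e.hom_inv_id]; rfl)
  inv_hom_id := ModOver.Hom.ext_app (Category.comp_id _) fun U s =>
    congr($(N.presheaf.map_id _) ((e.inv ≫ e.hom).app U s)).trans (by rw [e.inv_hom_id]; rfl)

/-- A fibered deformation of `X` over `A`: a pair `(𝒳, Ω_{𝒳/k})` with `𝒳` a deformation of `X`
over `A`. The second member is a sheaf on `𝒳` that is isomorphic to `Ω_{𝒳/k}`. -/
structure FiberedDeformation (X : Over (Spec (.of k))) (A : Art k) where
  deformation : Deformation X A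
  sheaf : deformation.toOver.left.Modules
  isOmega : Nonempty (sheaf ≅ omegaSheaf deformation.toOver)

namespace FiberedDeformation
variable {X : Over (Spec (.of k))} {A B C : Art k}

/-- The pair `(𝒳, sheaf)` as an object of `ModOver k`. -/
def toModOver (E : FiberedDeformation X A) : ModOver k := ⟨E.deformation.toOver, E.sheaf⟩

/-- Isomorphisms of fibered deformations: an isomorphism of the deformations together with an
isomorphism of the pairs `(𝒳, sheaf)` lying over it. -/
structure Iso (E E' : FiberedDeformation X A) where
  φ : Deformation.Iso E.deformation E'.deformation
  ψ : E.toModOver ≅ E'.toModOver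
  compat : ψ.hom.base.left = φ.e.hom

/-- The fibered deformation `(𝒳, Ω_{𝒳/k})` of a deformation `𝒳`. -/
def ofDeformation (D : Deformation X A) : FiberedDeformation X A where
  deformation := D
  sheaf := ((omega k).obj D.toOver).sheaf
  isOmega := ⟨.refl _⟩

theorem nonempty_iso_iff (E E' : FiberedDeformation X A) :
    Nonempty (Iso E E') ↔ E.deformation ≈ E'.deformation := by
  refine ⟨fun ⟨h⟩ => ⟨h.φ⟩, fun ⟨φ⟩ => ?_⟩
  obtain ⟨e⟩ := E.isOmega
  obtain ⟨e'⟩ := E'.isOmega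
  let o : E.deformation.toOver ≅ E'.deformation.toOver :=
    Over.isoMk φ.e (by simp [reassoc_of% φ.π])
  refine ⟨⟨φ, ModOver.fiberIso _ e ≪≫ (omega k).mapIso o ≪≫ (ModOver.fiberIso _ e').symm, ?_⟩⟩
  have : (𝟙 _ ≫ o.hom ≫ 𝟙 _).left = φ.e.hom := by simp [o]
  exact this

instance setoid (X : Over (Spec (.of k))) (A : Art k) : Setoid (FiberedDeformation X A) where
  r E E' := Nonempty (Iso E E')
  iseqv :=
    { refl E := (nonempty_iso_iff E E).2 (Setoid.refl _)
      symm h := (nonempty_iso_iff _ _).2 (Setoid.symm ((nonempty_iso_iff _ _).1 h))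
      trans h h' := (nonempty_iso_iff _ _).2
        (Setoid.trans ((nonempty_iso_iff _ _).1 h) ((nonempty_iso_iff _ _).1 h')) }

/-- A morphism `f : B ⟶ A` takes `(𝒳, Ω_{𝒳/k})` to `(𝒳_A, Ω_{𝒳_A/k})` with `𝒳_A` the base change of
the deformation `𝒳`. -/
def baseChange (f : B ⟶ A) (E : FiberedDeformation X B) : FiberedDeformation X A :=
  ofDeformation (E.deformation.baseChange f)

end FiberedDeformation

/-- The functor of isomorphism classes of fibered deformations of `X`. -/
def fiberedDefFunctor (X : Over (Spec (.of k))) : Art k ⥤ Type (u + 1) where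
  obj A := Quotient (FiberedDeformation.setoid X A)
  map f := TypeCat.ofHom (Quotient.map (FiberedDeformation.baseChange f) fun _ _ h =>
    (FiberedDeformation.nonempty_iso_iff _ _).2
      (Deformation.baseChange_congr f ((FiberedDeformation.nonempty_iso_iff _ _).1 h)))
  map_id A := by
    ext ⟨E⟩
    exact Quotient.sound ((FiberedDeformation.nonempty_iso_iff _ _).2 E.deformation.baseChange_id)
  map_comp {A B C} f g := by
    ext ⟨E⟩
    exact Quotient.sound
      ((FiberedDeformation.nonempty_iso_iff _ _).2 (E.deformation.baseChange_comp f g))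

/-! ### Smoothness -/

/-- Smoothness of a morphism of functors in the sense of Schlessinger: for every surjective
`f : B ⟶ A` the map `F(B) → F(A) ×_{G(A)} G(B)` is surjective. -/
def IsSmoothTrans {F G : Art k ⥤ Type (u + 1)} (θ : F ⟶ G) : Prop :=
  ∀ ⦃B A : Art k⦄ (f : B ⟶ A), Function.Surjective f.hom.hom →
    ∀ (x : F.obj A) (y : G.obj B), θ.app A x = G.map f y →
      ∃ z : F.obj B, F.map f z = x ∧ θ.app B z = y

/-- Smoothness of a functor `F` from `k`-schemes to a category `C`, whose objects `c` have a
deformation functor `Def c`, and where `Fdef` takes a deformation `𝒳` of `X` to the class of its image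
`F(𝒳)` as a deformation of `F(X)`: for every `X` the assignment `𝒳 ↦ F(𝒳)` is a well-defined morphism
of functors `D_X ⟶ D_{F(X)}`, and this morphism is smooth. -/
def IsSmoothFunctor {C : Type*} [Category C] (F : Over (Spec (.of k)) ⥤ C)
    (Def : C → Art k ⥤ Type (u + 1))
    (Fdef : ∀ (X : Over (Spec (.of k))) (A : Art k), Deformation X A → (Def (F.obj X)).obj A) :
    Prop :=
  ∀ X, ∃ θ : defFunctor X ⟶ Def (F.obj X),
    (∀ (A : Art k) (D : Deformation X A), θ.app A (Quotient.mk _ D) = Fdef X A D) ∧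
      IsSmoothTrans θ

end OmegaSmooth

end

open OmegaSmooth

noncomputable section

namespace OmegaSmooth

/-! ### Derivations and localization -/

section Localization

variable {R T N P : Type*} [CommRing R] [CommRing T] [Algebra R T] [AddCommGroup N] [Module R N]
  [AddCommGroup P] [Module R P] [Module T P] [IsScalarTower R T P]

/-! Smoothness is formal. By functoriality of `Ω`, an isomorphism of deformations always lifts to
the sheaves, so two fibered deformations are isomorphic exactly when the underlying deformations are
(`FiberedDeformation.nonempty_iso_iff`). A lift is then obtained by forgetting the sheaf.

The substance is that `Ω_{X/k}`, defined by sheafification, is quasi-coherent. For an open immersion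
`Spec R ⟶ X`, two sheaves on `Spec R` turn out to represent `k`-derivations of the structure sheaf:
the restriction of `Ω_{X/k}`, by the adjunction between restriction and pushforward, and
`(Ω_{R/k})^~`, by the adjunction between tilde and global sections. The second uses that a
derivation on an affine scheme is determined by its global sections and that `R → Ω_{R/k}` extends
to sheaves by the quotient rule. Hence the two are isomorphic (`tildeIsoRestrictOmega`), and a
presentation of the tilde sheaf gives one of `Ω_{X/k}` over each affine open. -/

theorem isUnit_algebraMap_end_of_isLocalization (T : Type*) {P : Type*} [CommRing T]
    [Algebra R T] [AddCommGroup P] [Module R P] [Module T P] [IsScalarTower R T P]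
    (S : Submonoid R) [IsLocalization S T] (s : S) :
    IsUnit (algebraMap R (Module.End R P) s) := by
  have := (Module.End.isUnit_iff _).1
    ((IsLocalization.map_units T s).map (algebraMap T (Module.End T P)))
  rw [Module.End.isUnit_iff]
  convert this using 1
  ext x
  simp

/-- Two derivations on `S⁻¹R` that agree on `R` are equal. -/
theorem derivation_ext_of_isLocalization (S : Submonoid R) [IsLocalization S T] {D D' : T →+ P}
    (hD : ∀ a b, D (a * b) = a • D b + b • D a) (hD' : ∀ a b, D' (a * b) = a • D' b + b • D' a)
    (h : ∀ a : R, D (algebraMap R T a) = D' (algebraMap R T a)) : D = D' := by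
  ext x
  obtain ⟨⟨a, s⟩, hx⟩ := IsLocalization.surj S x
  -- With `x * s = a`, Leibniz gives `D a = x • D s + s • D x`; the values at `a` and `s` are known
  -- and `s` acts injectively on `P`.
  apply ((Module.End.isUnit_iff _).1
    (isUnit_algebraMap_end_of_isLocalization T (P := P) S s)).injective
  have h1 := h a
  rw [← hx, hD, hD', h s] at h1
  simpa using h1

variable (S : Submonoid R) [IsLocalization S T] (f : N →ₗ[R] P)

/-- The extension of a derivation `D : R → N` to a derivation `S⁻¹R → P`, for an `S⁻¹R`-module `P`
and an `R`-linear map `N → P`. -/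
def localizedDerivation (D : Derivation ℤ R N) : T →+ P :=
  -- `Ω_{R/ℤ} → Ω_{T/ℤ}` is a localization at `S`, so the linear map attached to `D` extends.
  -- Additivity and Leibniz suffice here, hence the base `ℤ`.
  (IsLocalizedModule.lift S (KaehlerDifferential.map ℤ ℤ R T) (f ∘ₗ D.liftKaehlerDifferential)
    (isUnit_algebraMap_end_of_isLocalization T S)).toAddMonoidHom.comp
      (KaehlerDifferential.D ℤ T).toLinearMap.toAddMonoidHom

theorem localizedDerivation_mul (D : Derivation ℤ R N) (a b : T) :
    (localizedDerivation S f D : T →+ P) (a * b) =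
      a • localizedDerivation S f D b + b • localizedDerivation S f D a := by
  -- The lift is only `R`-linear as constructed; between `T`-modules it is automatically `T`-linear,
  -- so composing with the universal derivation gives a derivation of `T`.
  have := (((IsLocalizedModule.lift S (KaehlerDifferential.map ℤ ℤ R T)
    (f ∘ₗ D.liftKaehlerDifferential)
    (isUnit_algebraMap_end_of_isLocalization T S)).extendScalarsOfIsLocalization S T).compDer
      (KaehlerDifferential.D ℤ T)).leibniz a b
  exact this

theorem localizedDerivation_algebraMap (D : Derivation ℤ R N) (a : R) :
    (localizedDerivation S f D : T →+ P) (algebraMap R T a) = f (D a) := by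
  have := IsLocalizedModule.lift_apply S (KaehlerDifferential.map ℤ ℤ R T)
    (f ∘ₗ D.liftKaehlerDifferential)
    (isUnit_algebraMap_end_of_isLocalization T S) (KaehlerDifferential.D ℤ R a)
  rw [KaehlerDifferential.map_D] at this
  refine this.trans ?_
  simp

/-- The quotient rule, obtained by applying Leibniz to `s * (a / s) = a`. It shows that the extended
derivation takes fractions to fractions, as needed for sections of `N^~`. -/
theorem localizedDerivation_mk (D : Derivation ℤ R N) (a : R) (s : S) :
    (localizedDerivation S (LocalizedModule.mkLinearMap S N) D :
      LocalizedModule S R →+ LocalizedModule S N) (LocalizedModule.mk a s) =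
      LocalizedModule.mk ((s : R) • D a - a • D s) (s * s) := by
  set E : LocalizedModule S R →+ LocalizedModule S N :=
    localizedDerivation S (LocalizedModule.mkLinearMap S N) D with hE
  have h (b : R) : E (algebraMap R (LocalizedModule S R) b) = LocalizedModule.mk (D b) 1 :=
    localizedDerivation_algebraMap S (LocalizedModule.mkLinearMap S N) D b
  apply ((Module.End.isUnit_iff _).1
    (isUnit_algebraMap_end_of_isLocalization (LocalizedModule S R) S s)).injective
  have hx : algebraMap R (LocalizedModule S R) s * LocalizedModule.mk a s = algebraMap R _ a := by
    rw [← Algebra.smul_def]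
    refine (LocalizedModule.smul'_mk _ _ _).trans ?_
    exact LocalizedModule.mk_cancel s a
  have h1 := h a
  rw [← hx, hE, localizedDerivation_mul, ← hE, h s, ← eq_sub_iff_add_eq] at h1
  rw [algebraMap_smul] at h1
  refine h1.trans ?_
  simp only [Module.algebraMap_end_apply]
  rw [LocalizedModule.smul'_mk]
  have h2 : (LocalizedModule.mk a s : LocalizedModule S R) • (LocalizedModule.mk (D s) 1 :
      LocalizedModule S N) = LocalizedModule.mk (a • D s) s := by
    refine (LocalizedModule.mk_smul_mk ..).trans ?_
    rw [mul_one]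
  rw [h2, sub_eq_iff_eq_add, LocalizedModule.mk_add_mk, LocalizedModule.mk_eq]
  refine ⟨1, ?_⟩
  simp only [Submonoid.smul_def, one_smul, Submonoid.coe_mul, smul_sub,
    smul_add, smul_smul]
  module

end Localization

/-! ### Extending a derivation `R → N` to sheaves on `Spec R` -/

section Tilde

variable {R : CommRingCat.{u}} {N : ModuleCat.{u} R} (D : Derivation ℤ R N)

/-- The derivation `R_x → N_x` induced by a derivation `R → N`. -/
def derivationAtPrime (x : PrimeSpectrum R) :
    LocalizedModule x.asIdeal.primeCompl R →+ LocalizedModule x.asIdeal.primeCompl N :=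
  localizedDerivation x.asIdeal.primeCompl
    (LocalizedModule.mkLinearMap x.asIdeal.primeCompl N) D

theorem derivationAtPrime_mk (x : PrimeSpectrum R) (a : R) (t : x.asIdeal.primeCompl) :
    derivationAtPrime D x (LocalizedModule.mk a t) =
      LocalizedModule.mk ((t : R) • D a - a • D t) (t * t) :=
  localizedDerivation_mk _ D a t

theorem derivationAtPrime_mul (x : PrimeSpectrum R) (a b : LocalizedModule x.asIdeal.primeCompl R) :
    derivationAtPrime D x (a * b) = a • derivationAtPrime D x b + b • derivationAtPrime D x a :=
  localizedDerivation_mul _ _ D a b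

theorem derivationAtPrime_mk_one (x : PrimeSpectrum R) (a : R) :
    derivationAtPrime D x (LocalizedModule.mk a 1) = LocalizedModule.mk (D a) 1 :=
  localizedDerivation_algebraMap x.asIdeal.primeCompl _ D a

/-- The derivation of the structure sheaf with values in `N^~` induced by a derivation `R → N`. -/
def tildeDerivation (U : (Spec R).Opens) : Γ(Spec R, U) →+ Γ(tilde N, U) where
  toFun s := ⟨fun x => derivationAtPrime D x.1 (s.1 x), by
    intro x
    obtain ⟨V, hxV, i, a, t, h⟩ := s.2 x
    -- Where the section is `a / t`, its image is the fraction given by the quotient rule; `t * t`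
    -- avoids a prime as soon as `t` does.
    refine ⟨V, hxV, i, t • D a - a • D t, t * t, fun y => ?_⟩
    obtain ⟨hy, e⟩ := h y
    refine ⟨fun h' => hy ((PrimeSpectrum.isPrime y.1).mul_mem_iff_mem_or_mem.1 h' |>.elim id id), ?_⟩
    exact (congrArg (derivationAtPrime D y.1) e).trans
      (derivationAtPrime_mk D y.1 a ⟨t, hy⟩)⟩
  map_zero' := Subtype.ext <| funext fun x => map_zero (derivationAtPrime D x.1)
  map_add' s t := Subtype.ext <| funext fun x => map_add (derivationAtPrime D x.1) (s.1 x) (t.1 x)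

theorem tildeDerivation_mul (U : (Spec R).Opens) (a b : Γ(Spec R, U)) :
    tildeDerivation D U (a * b) = a • tildeDerivation D U b + b • tildeDerivation D U a :=
  Subtype.ext <| funext fun x =>
    derivationAtPrime_mul D x.1 (a.1 x) (b.1 x)

theorem tildeDerivation_map {U V : (Spec R).Opens} (i : U ⟶ V) (a : Γ(Spec R, V)) :
    tildeDerivation D U ((Spec R).presheaf.map i.op a) =
      (tilde N).presheaf.map i.op (tildeDerivation D V a) :=
  rfl

theorem tildeDerivation_top (a : R) :
    tildeDerivation D ⊤ ((Scheme.ΓSpecIso R).inv a) = tilde.toOpen N ⊤ (D a) :=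
  Subtype.ext <| funext fun x => derivationAtPrime_mk_one D x.1 a

end Tilde

variable {k : Type u} [Field k]

/-! ### Functoriality of derivations -/

section Functoriality

variable {X Y : Over (Spec (.of k))}

theorem structMap_app_comp_app (f : X ⟶ Y) (U : Y.left.Opens) :
    (structMap Y).app (op U) ≫ f.left.app U = (structMap X).app (op (f.left ⁻¹ᵁ U)) := by
  have hw : f.left ≫ Y.hom = X.hom := Over.w f
  have : X.hom.appLE ⊤ (f.left ⁻¹ᵁ U) (by simp) = Y.hom.appLE ⊤ U (by simp) ≫ f.left.app U := by
    rw [Scheme.Hom.app_eq_appLE]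
    refine Eq.trans ?_ (Scheme.Hom.appLE_comp_appLE f.left Y.hom _ _ _ _ _).symm
    simp only [hw]
  simp only [structMap, Category.assoc]
  rw [this]

theorem structMap_app_comp_appIso_inv (f : X ⟶ Y) [IsOpenImmersion f.left] (U : X.left.Opens) :
    (structMap X).app (op U) ≫ (f.left.appIso U).inv = (structMap Y).app (op (f.left ''ᵁ U)) := by
  rw [Iso.comp_inv_eq, Scheme.Hom.appIso_hom, ← Category.assoc, structMap_app_comp_app]
  -- The two sides differ by the restriction map along `f⁻¹(f(U)) = U`, with which constants are
  -- compatible.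
  exact (Category.id_comp _).symm.trans
    ((structMap X).naturality (eqToHom (f.left.preimage_image_eq U).symm).op)

/-- The composition of a derivation with a morphism of sheaves of modules. -/
def Deriv.comp {M N : X.left.Modules} (D : Deriv X M) (α : M ⟶ N) : Deriv X N where
  d U := (α.app U).hom.comp (D.d U)
  d_mul U a b := by
    refine (congrArg (α.app U) (D.d_mul U a b)).trans ?_
    rw [map_add, Scheme.Modules.Hom.app_smul, Scheme.Modules.Hom.app_smul]
    rfl
  d_map {U V} i a := by
    refine (congrArg (α.app U) (D.d_map i a)).trans ?_
    exact congr($(α.mapPresheaf.naturality i.op) (D.d V a))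
  d_const U c := (congrArg (α.app U) (D.d_const U c)).trans (map_zero _)

/-- The derivation of `𝒪_Y` with values in `f_* M` induced by a derivation of `𝒪_X` with values
in `M`. -/
def Deriv.push (f : X ⟶ Y) {M : X.left.Modules} (D : Deriv X M) :
    Deriv Y ((Scheme.Modules.pushforward f.left).obj M) where
  d U := (D.d (f.left ⁻¹ᵁ U)).comp (f.left.app U).hom.toAddMonoidHom
  d_mul U a b := by
    have := D.d_mul (f.left ⁻¹ᵁ U) (f.left.app U a) (f.left.app U b)
    rw [← map_mul] at this
    exact this
  d_map {U V} i a := by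
    refine Eq.trans ?_ (D.d_map ((TopologicalSpace.Opens.map f.left.base).map i) (f.left.app V a))
    exact congrArg (D.d (f.left ⁻¹ᵁ U)) congr($(f.left.naturality i.op) a)
  d_const U c := by
    refine Eq.trans ?_ (D.d_const (f.left ⁻¹ᵁ U) c)
    exact congrArg (D.d (f.left ⁻¹ᵁ U)) congr($(structMap_app_comp_app f U) c)

/-- The restriction of a derivation along an open immersion. -/
def Deriv.restrict (f : X ⟶ Y) [IsOpenImmersion f.left] {M : Y.left.Modules} (D : Deriv Y M) :
    Deriv X (M.restrict f.left) where
  d U := (D.d (f.left ''ᵁ U)).comp (f.left.appIso U).inv.hom.toAddMonoidHom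
  d_mul U a b := by
    have := D.d_mul (f.left ''ᵁ U) ((f.left.appIso U).inv a) ((f.left.appIso U).inv b)
    rw [← map_mul] at this
    exact this
  d_map {U V} i a := by
    refine Eq.trans ?_ (D.d_map (f.left.opensFunctor.map i) ((f.left.appIso V).inv a))
    refine congrArg (D.d (f.left ''ᵁ U)) ?_
    exact congr($(Scheme.Hom.appIso_inv_naturality f.left i.op) a)
  d_const U c := by
    refine Eq.trans ?_ (D.d_const (f.left ''ᵁ U) c)
    exact congrArg (D.d (f.left ''ᵁ U)) congr($(structMap_app_comp_appIso_inv f U) c)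

/-- The adjunction unit is restriction of sections, which commutes with `d`. This carries statements
about differentials across the adjunction. -/
theorem restrict_univDeriv_app (f : X ⟶ Y) [IsOpenImmersion f.left] (U : Y.left.Opens)
    (a : Γ(Y.left, U)) :
    ((univDeriv Y).restrict f).d (f.left ⁻¹ᵁ U) (f.left.app U a) =
      ((Scheme.Modules.restrictAdjunction f.left).unit.app (omegaSheaf Y)).app U
        ((univDeriv Y).d U a) := by
  rw [Scheme.Modules.restrictAdjunction_unit_app_app]
  refine Eq.trans ?_ ((univDeriv Y).d_map (homOfLE (f.left.image_preimage_le U)) a)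
  refine congrArg ((univDeriv Y).d (f.left ''ᵁ f.left ⁻¹ᵁ U)) ?_
  exact congr($(f.left.app_appIso_inv U) a)

/-- The restriction of `Ω_{Y/k}` along an open immersion is generated by differentials. -/
theorem restrict_omega_hom_ext (f : X ⟶ Y) [IsOpenImmersion f.left] {M : X.left.Modules}
    (α β : (omegaSheaf Y).restrict f.left ⟶ M)
    (h : ∀ U a, α.app U (((univDeriv Y).restrict f).d U a) =
      β.app U (((univDeriv Y).restrict f).d U a)) : α = β := by
  -- After transposition the source is `Ω_{Y/k}` itself, where differentials determine morphisms.
  apply ((Scheme.Modules.restrictAdjunction f.left).homEquiv _ _).injective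
  apply omega_hom_ext
  intro U a
  rw [Adjunction.homEquiv_unit, Adjunction.homEquiv_unit]
  refine (congrArg (α.app (f.left ⁻¹ᵁ U)) (restrict_univDeriv_app f U a)).symm.trans ?_
  refine Eq.trans ?_ (congrArg (β.app (f.left ⁻¹ᵁ U)) (restrict_univDeriv_app f U a))
  exact h _ _

/-- The morphism from the restriction of `Ω_{Y/k}` along an open immersion that is induced by a
derivation. -/
def Deriv.restrictDesc (f : X ⟶ Y) [IsOpenImmersion f.left] {M : X.left.Modules} (D : Deriv X M) :
    (omegaSheaf Y).restrict f.left ⟶ M :=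
  ((Scheme.Modules.restrictAdjunction f.left).homEquiv _ _).symm (D.push f).desc

theorem Deriv.restrictDesc_d (f : X ⟶ Y) [IsOpenImmersion f.left] {M : X.left.Modules}
    (D : Deriv X M) (U : X.left.Opens) (a : Γ(X.left, U)) :
    (D.restrictDesc f).app U (((univDeriv Y).restrict f).d U a) = D.d U a := by
  rw [Deriv.restrictDesc, Adjunction.homEquiv_counit, Scheme.Modules.Hom.comp_app,
    Scheme.Modules.restrictAdjunction_counit_app_app]
  have h1 := (D.push f).desc_d (f.left ''ᵁ U) ((f.left.appIso U).inv a)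
  refine (congrArg (M.presheaf.map (eqToHom (f.left.preimage_image_eq U).symm).op) h1).trans ?_
  refine (D.d_map (eqToHom (f.left.preimage_image_eq U).symm)
    (f.left.app (f.left ''ᵁ U) ((f.left.appIso U).inv a))).symm.trans ?_
  refine congrArg (D.d U) ?_
  exact congr($(f.left.appIso_inv_app_presheafMap U) a)

end Functoriality

/-! ### Differentials on an affine scheme -/

section Affine

variable {R : CommRingCat.{u}} (φ : CommRingCat.of k ⟶ R)

/-- The spectrum of a `k`-algebra, as a `k`-scheme. -/
abbrev specOver : Over (Spec (.of k)) := Over.mk (Spec.map φ)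

theorem structMap_specOver_app_top :
    (structMap (specOver φ)).app (op ⊤) = φ ≫ (Scheme.ΓSpecIso R).inv := by
  rw [Scheme.ΓSpecIso_inv_naturality]
  simp only [structMap]
  congr 1

/-- Sections over a basic open form the localization of `R` away from `r`. -/
theorem derivation_ext_of_eq_basicOpen {M : (Spec R).Modules} {U : (Spec R).Opens} {r : R}
    (hU : U = PrimeSpectrum.basicOpen r) {D D' : Γ(Spec R, U) →+ Γ(M, U)}
    (hD : ∀ a b, D (a * b) = a • D b + b • D a) (hD' : ∀ a b, D' (a * b) = a • D' b + b • D' a)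
    (h : ∀ a : R, D (algebraMap R _ a) = D' (algebraMap R _ a)) : D = D' := by
  have : IsLocalization.Away r Γ(Spec R, U) := by
    subst hU
    exact StructureSheaf.IsLocalization.to_basicOpen R r
  exact derivation_ext_of_isLocalization (Submonoid.powers r) hD hD' h

/-- Derivations of the structure sheaf of an affine scheme that agree on global sections are
equal. -/
theorem Deriv.ext_of_top {M : (specOver φ).left.Modules} {D D' : Deriv (specOver φ) M}
    (h : ∀ r : R, D.d ⊤ ((Scheme.ΓSpecIso R).inv r) = D'.d ⊤ ((Scheme.ΓSpecIso R).inv r))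
    (U : (Spec R).Opens) (a : Γ(Spec R, U)) : D.d U a = D'.d U a := by
  have hb (r : R) : D.d (PrimeSpectrum.basicOpen r) = D'.d (PrimeSpectrum.basicOpen r) := by
    refine derivation_ext_of_eq_basicOpen (M := M) rfl (D.d_mul _) (D'.d_mul _) (fun s => ?_)
    have h1 := D.d_map (homOfLE le_top : PrimeSpectrum.basicOpen r ⟶ ⊤)
      ((Scheme.ΓSpecIso R).inv s)
    have h2 := D'.d_map (homOfLE le_top : PrimeSpectrum.basicOpen r ⟶ ⊤)
      ((Scheme.ΓSpecIso R).inv s)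
    exact (h1.trans (congrArg _ (h s))).trans h2.symm
  -- Basic opens form a basis and `M` is a sheaf, so agreement on them is enough.
  apply TopCat.Presheaf.IsSheaf.section_ext M.isSheaf
  intro x hx
  obtain ⟨_, ⟨_, ⟨r, rfl⟩, rfl⟩, hxr, hrU : PrimeSpectrum.basicOpen _ ≤ _⟩ :=
    PrimeSpectrum.isBasis_basic_opens.exists_subset_of_mem_open hx U.2
  refine ⟨_, hrU, hxr, ?_⟩
  refine (D.d_map (homOfLE hrU) a).symm.trans (Eq.trans ?_ (D'.d_map (homOfLE hrU) a))
  exact DFunLike.congr_fun (hb r) _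

/-- The universal derivation `R → Ω_{R/k}`, as a derivation over `ℤ`. -/
def kaehlerDerivation : Derivation ℤ R (CommRingCat.KaehlerDifferential φ) where
  toFun := CommRingCat.KaehlerDifferential.d
  map_add' := (CommRingCat.KaehlerDifferential.D φ).d_add
  map_smul' n a := map_zsmul (AddMonoidHom.mk' _ (CommRingCat.KaehlerDifferential.D φ).d_add) n a
  map_one_eq_zero' := by
    have := (CommRingCat.KaehlerDifferential.D φ).d_map 1
    rwa [map_one] at this
  leibniz' := (CommRingCat.KaehlerDifferential.D φ).d_mul

/-- The canonical derivation of the structure sheaf of `Spec R` with values in `(Ω_{R/k})^~`. -/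
def tildeDeriv : Deriv (specOver φ) (tilde (CommRingCat.KaehlerDifferential φ)) where
  d U := tildeDerivation (kaehlerDerivation φ) U
  d_mul U a b := tildeDerivation_mul (kaehlerDerivation φ) U a b
  d_map i a := tildeDerivation_map (kaehlerDerivation φ) i a
  d_const U c := by
    -- A constant on `U` is restricted from a global one, which reduces the claim to `d (φ c) = 0`
    -- in `Ω_{R/k}`.
    have h1 : (structMap (specOver φ)).app (op U) c =
        (Spec R).presheaf.map (homOfLE le_top : U ⟶ ⊤).op ((Scheme.ΓSpecIso R).inv (φ c)) := by
      have := (structMap (specOver φ)).naturality (homOfLE le_top : U ⟶ ⊤).op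
      rw [structMap_specOver_app_top] at this
      exact congr($this c)
    rw [h1]
    refine (tildeDerivation_map (kaehlerDerivation φ) (homOfLE le_top : U ⟶ ⊤) _).trans ?_
    rw [tildeDerivation_top]
    have h2 : kaehlerDerivation φ (φ c) = 0 := (CommRingCat.KaehlerDifferential.D φ).d_map c
    rw [h2, map_zero]
    exact map_zero _

variable {φ}

theorem tilde_homEquiv_apply {N : ModuleCat.{u} R} {M : (Spec R).Modules} (α : tilde N ⟶ M)
    (x : N) :
    (tilde.adjunction.homEquiv N M α x : Γ(M, ⊤)) = α.app ⊤ (tilde.toOpen N ⊤ x) :=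
  rfl

/-- The derivation `R → Γ(Spec R, M)` given by a derivation of the structure sheaf. -/
def Deriv.globalSections {M : (specOver φ).left.Modules} (D : Deriv (specOver φ) M) :
    (moduleSpecΓFunctor (R := R).obj M).Derivation φ :=
  ModuleCat.Derivation.mk (fun r => D.d ⊤ ((Scheme.ΓSpecIso R).inv r))
    (fun a b => (congrArg (D.d ⊤) (map_add _ a b)).trans (map_add _ _ _))
    (fun a b => (congrArg (D.d ⊤) (map_mul _ a b)).trans (D.d_mul _ _ _))
    (fun c => (congrArg (D.d ⊤) congr($(structMap_specOver_app_top φ) c)).symm.trans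
      (D.d_const ⊤ c))

/-- The morphism `(Ω_{R/k})^~ ⟶ M` induced by a derivation. -/
def Deriv.tildeDesc {M : (specOver φ).left.Modules} (D : Deriv (specOver φ) M) :
    tilde (CommRingCat.KaehlerDifferential φ) ⟶ M :=
  (tilde.adjunction.homEquiv (CommRingCat.KaehlerDifferential φ) M).symm D.globalSections.desc

/-- Both sides are derivations in `a`, so global sections suffice; there the adjunction reduces the
claim to the universal property of `Ω_{R/k}`. -/
theorem Deriv.tildeDesc_d {M : (specOver φ).left.Modules} (D : Deriv (specOver φ) M)
    (U : (Spec R).Opens) (a : Γ(Spec R, U)) :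
    D.tildeDesc.app U ((tildeDeriv φ).d U a) = D.d U a := by
  refine Deriv.ext_of_top φ (D := (tildeDeriv φ).comp D.tildeDesc) (D' := D) (fun r => ?_) U a
  refine (congrArg (D.tildeDesc.app ⊤) (tildeDerivation_top (kaehlerDerivation φ) r)).trans ?_
  refine (tilde_homEquiv_apply D.tildeDesc (kaehlerDerivation φ r)).symm.trans ?_
  refine Eq.trans ?_ (D.globalSections.desc_d r)
  exact congr($((tilde.adjunction.homEquiv (CommRingCat.KaehlerDifferential φ) M).apply_symm_apply
    D.globalSections.desc) (CommRingCat.KaehlerDifferential.d r))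

theorem tilde_hom_ext {M : (specOver φ).left.Modules}
    (α β : tilde (CommRingCat.KaehlerDifferential φ) ⟶ M)
    (h : ∀ U a, α.app U ((tildeDeriv φ).d U a) = β.app U ((tildeDeriv φ).d U a)) : α = β := by
  apply (tilde.adjunction.homEquiv (CommRingCat.KaehlerDifferential φ) M).injective
  apply CommRingCat.KaehlerDifferential.ext
  intro b
  have h1 := h ⊤ ((Scheme.ΓSpecIso R).inv b)
  have h2 := tildeDerivation_top (kaehlerDerivation φ) b
  exact (congrArg (α.app ⊤) h2).symm.trans (h1.trans (congrArg (β.app ⊤) h2))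

/-- The restriction of `Ω_{X/k}` along an open immersion `Spec R ⟶ X` is `(Ω_{R/k})^~`. -/
def tildeIsoRestrictOmega {X : Over (Spec (.of k))} (f : specOver φ ⟶ X) [IsOpenImmersion f.left] :
    tilde (CommRingCat.KaehlerDifferential φ) ≅ (omegaSheaf X).restrict f.left where
  hom := ((univDeriv X).restrict f).tildeDesc
  inv := (tildeDeriv φ).restrictDesc f
  -- Each composite fixes the differentials, and these determine morphisms out of either sheaf.
  hom_inv_id := tilde_hom_ext _ _ fun U a =>
    (congrArg (((tildeDeriv φ).restrictDesc f).app U)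
      (((univDeriv X).restrict f).tildeDesc_d U a)).trans ((tildeDeriv φ).restrictDesc_d f U a)
  inv_hom_id := restrict_omega_hom_ext f _ _ fun U a =>
    (congrArg (((univDeriv X).restrict f).tildeDesc.app U)
      ((tildeDeriv φ).restrictDesc_d f U a)).trans (((univDeriv X).restrict f).tildeDesc_d U a)

end Affine

/-! ### Quasi-coherence of the sheaf of differentials -/

/-- The transport of a presentation along an isomorphism. -/
def presentationOfIso {X : Scheme.{u}} {M N : X.Modules} (e : M ≅ N)
    (P : SheafOfModules.Presentation.{u} M) : SheafOfModules.Presentation.{u} N :=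
  have : @IsIso (SheafOfModules X.ringCatSheaf) _ M N e.hom := (inferInstance : IsIso e.hom)
  SheafOfModules.Presentation.ofIsIso.{u, u, u} e.hom P

/-- A presentation of the restriction of a sheaf of modules to an open subscheme gives one of the
restriction to the corresponding slice site. -/
def presentationOver {X : Scheme.{u}} (M : X.Modules) (U : X.Opens)
    (P : (M.restrict U.ι).Presentation) : (SheafOfModules.over M U).Presentation :=
  let E := Scheme.Modules.overEquiv U
  -- Transporting a presentation along a functor requires that it preserve the unit sheaf and
  -- colimits; `E.inverse` does both, being half of an equivalence that matches the unit sheaves.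
  let η : SheafOfModules.unit.{u} (X.ringCatSheaf.over U) ≅
      E.inverse.obj (SheafOfModules.unit.{u} U.toScheme.ringCatSheaf) :=
    E.unitIso.app _ ≪≫ E.inverse.mapIso (Iso.refl _)
  let e : E.inverse.obj (M.restrict U.ι) ≅ SheafOfModules.over M U :=
    E.inverse.mapIso ((Scheme.Modules.overFunctorEquiv U).symm.app M) ≪≫ (E.unitIso.app _).symm
  let F : SheafOfModules.{u} U.toScheme.ringCatSheaf ⥤ SheafOfModules.{u} (X.ringCatSheaf.over U) :=
    E.inverse
  have : Limits.PreservesColimitsOfSize.{u, u} F :=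
    E.symm.toAdjunction.leftAdjoint_preservesColimits
  (P.map F η).ofIsIso e.hom

/-- Quasi-coherence is phrased through presentations on slice sites; `presentationOver` converts
those on open subschemes. -/
theorem isQuasicoherent_of_isOpenCover {X : Scheme.{u}} (M : X.Modules) {ι : Type u}
    (U : ι → X.Opens) (hU : TopologicalSpace.IsOpenCover U)
    (P : ∀ i, (M.restrict (U i).ι).Presentation) : M.IsQuasicoherent :=
  let q : SheafOfModules.QuasicoherentData.{u, u, u, u} (R := X.ringCatSheaf) M :=
    { I := ι
      X := U
      coversTop := (Opens.coversTop_iff X U).2 hU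
      presentation i := presentationOver M (U i) (P i) }
  q.isQuasicoherent

/-- The presentation of `Ω_{X/k}` over an affine open subscheme. -/
def presentationOmega (X : Over (Spec (.of k))) {U : X.left.Opens} (hU : IsAffineOpen U) :
    ((omegaSheaf X).restrict U.ι).Presentation := by
  -- The `k`-algebra structure that makes `hU.fromSpec` a morphism over `k`.
  let φ : CommRingCat.of k ⟶ Γ(X.left, U) := Spec.preimage (hU.fromSpec ≫ X.hom)
  let f : specOver φ ⟶ X := Over.homMk hU.fromSpec (by simp [φ])
  have : IsOpenImmersion f.left := inferInstanceAs (IsOpenImmersion hU.fromSpec)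
  let P : (tilde (CommRingCat.KaehlerDifferential φ)).Presentation :=
    -- All elements serve as generators and all relations among them as relations.
    presentationTilde.{u} _ .univ (by simp) _ (Submodule.span_eq _)
  -- The inclusion of `U` factors as `U ≅ Spec Γ(X, U) ⟶ X`.
  let e : (Scheme.Modules.restrictFunctor hU.fromSpec) ⋙
      Scheme.Modules.restrictFunctor hU.isoSpec.hom ≅ Scheme.Modules.restrictFunctor U.ι :=
    (Scheme.Modules.restrictFunctorComp _ _).symm ≪≫
      Scheme.Modules.restrictFunctorCongr (by simp)
  exact presentationOfIso (e.app (omegaSheaf X)) <|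
    Scheme.Modules.presentationRestrict hU.isoSpec.hom
      (presentationOfIso (tildeIsoRestrictOmega f) P)

theorem isQuasicoherent_omegaSheaf (X : Over (Spec (.of k))) : (omegaSheaf X).IsQuasicoherent :=
  isQuasicoherent_of_isOpenCover _ (fun U : X.left.affineOpens => U.1)
    (iSup_affineOpens_eq_top X.left) fun U => presentationOmega X U.2

/-! ### Smoothness -/

/-- The morphism of functors `D_X ⟶ D_{Ω_{X/k}}` that takes `𝒳` to `(𝒳, Ω_{𝒳/k})`. -/
def defToFibered (X : Over (Spec (.of k))) : defFunctor X ⟶ fiberedDefFunctor X where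
  app A := TypeCat.ofHom (Quotient.map FiberedDeformation.ofDeformation fun _ _ h =>
    (FiberedDeformation.nonempty_iso_iff _ _).2 h)
  naturality A B f := by
    ext ⟨D⟩
    rfl

theorem isSmoothTrans_defToFibered (X : Over (Spec (.of k))) : IsSmoothTrans (defToFibered X) := by
  intro B A f _ x y h
  induction x using Quotient.inductionOn with | _ D
  induction y using Quotient.inductionOn with | _ E
  have h' := (FiberedDeformation.nonempty_iso_iff _ _).1 (Quotient.exact h)
  -- The deformation underlying `E` is the lift: by `h'` its base change is isomorphic to `D`, and
  -- the sheaf of `E` is already a copy of its `Ω`.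
  exact ⟨Quotient.mk _ E.deformation, Quotient.sound (Setoid.symm h'),
    Quotient.sound ((FiberedDeformation.nonempty_iso_iff _ _).2 (Setoid.refl _))⟩

end OmegaSmooth

end

theorem mainTheorem7 (k : Type u) [Field k] :
    ∃ h : ∀ X : Over (Spec (.of k)), isQCoh k ((omega k).obj X),
      IsSmoothFunctor (C := QCoh k) ((isQCoh k).lift (omega k) h)
        (fun E => fiberedDefFunctor E.obj.base)
        (fun _ _ D => Quotient.mk _ (FiberedDeformation.ofDeformation D)) :=
  ⟨isQuasicoherent_omegaSheaf, fun X => ⟨defToFibered X, fun _ _ => rfl,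
    isSmoothTrans_defToFibered X⟩⟩
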